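/- For an integer $d\ge 1$ let $$\mathcal R_{\mathrm{ST}}=\bigl\{\{x\in\mathbb R^d : a\le x_i\le b\} : 1\le i\le d,\ a,b\in\mathbb R\bigr\}$$ be the family of all axis-aligned strips in $\mathbb R^d$. For a finite set $V\subset\mathbb R^d$ and a positive integer $m$, let $\mathcal H(V,\mathcal R_{\mathrm{ST}},m)$ be the hypergraph with vertex set $V$ whose hyperedges are the sets $e=V\cap R$ with $R\in\mathcal R_{\mathrm{ST}}$ and $|e|=m$. For a positive integer $t$, a set $X\subseteq V$ is a $t$-shallow hitting set of a hypergraph $H=(V,E)$ if $1\le |e\cap X|\le t$ for every $e\in E$. Theorem. There is a function $t$ from the nonnegative integers to the positive integers with $t(d)=3\mathrm e\,d\,(1+o(1))$ as $d\to\infty$ (where $\mathrm e$ is Euler's number) such that for every $d\ge 1$, every positive integer $m$ and every finite set $V\subset\mathbb R^d$ (not necessarily in general position), the hypergraph $\mathcal H(V,\mathcal R_{\mathrm{ST}},m)$ has a $t(d)$-shallow hitting set. -/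

import Mathlib

/-- The axis-aligned strip `{x ∈ ℝ^d | a ≤ x_i ≤ b}` orthogonal to the `i`-th coordinate axis. -/
def strip {d : ℕ} (i : Fin d) (a b : ℝ) : Set (EuclideanSpace ℝ (Fin d)) :=
  {x | a ≤ x i ∧ x i ≤ b}

/-- The range family of all axis-aligned strips in `ℝ^d`, for all coordinate directions. -/
def stripFamily (d : ℕ) : Set (Set (EuclideanSpace ℝ (Fin d))) :=
  {R | ∃ (i : Fin d) (a b : ℝ), R = strip i a b}

/-- The range capturing hypergraph of the point set `V` and the range family `F`: the vertex set
is `V`, and the hyperedges are all sets `V ∩ R` with `R ∈ F`. -/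
def rangeHypergraph {P : Type*} (V : Set P) (F : Set (Set P)) : Hypergraph P where
  vertexSet := V
  edgeSet := {e | ∃ R ∈ F, e = V ∩ R}
  subset_vertexSet_of_mem_edgeSet' := by
    rintro e ⟨R, _, rfl⟩
    exact Set.inter_subset_left

/-- The subhypergraph of the range capturing hypergraph of `V` and `F` that has the same vertex
set and consists of all hyperedges with exactly `m` elements. -/
def uniformRangeHypergraph {P : Type*} (V : Set P) (F : Set (Set P)) (m : ℕ) : Hypergraph P where
  vertexSet := V
  edgeSet := {e | e ∈ (rangeHypergraph V F).edgeSet ∧ e.encard = m}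
  subset_vertexSet_of_mem_edgeSet' := fun _ he =>
    (rangeHypergraph V F).subset_vertexSet_of_mem_edgeSet' he.1

/-- `X` is a `t`-shallow hitting set of `H`: a set of vertices that contains at least one and
at most `t` vertices of every hyperedge. -/
def IsShallowHittingSet {P : Type*} (H : Hypergraph P) (t : ℕ) (X : Set P) : Prop :=
  X ⊆ H.vertexSet ∧ ∀ e ∈ H.edgeSet, 1 ≤ (e ∩ X).encard ∧ (e ∩ X).encard ≤ t

/-! In each coordinate order, cut the points into consecutive blocks of size `B = ⌈m/2⌉`. A strip
with `m` points is a run of `m` consecutive points, so it contains a full block and meets at most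
three blocks. Each point lies in only `d` blocks, so for `d ≤ B` Beck–Fiala (`beck_fiala_rounding`)
rounds the constant weight `d / B` to a set with at least one point in every full block and at most
`2 * d` in any block. Strips thus get between 1 and `6 * d` points, and `6 ≤ 3e`. -/

/-! ### Beck–Fiala rounding -/

open Finset in
/-- If every vertex lies in at most `d` of the sets `e i`, then on any nonempty vertex set `F`
there is a nonzero weighting that sums to zero on every `e i` meeting `F` in more than `d`
vertices. -/
theorem exists_ne_zero_sum_eq_zero_of_degree_le {α ι : Type*} [Fintype α] [DecidableEq α]
    [Fintype ι] (e : ι → Finset α) (d : ℕ) (hdeg : ∀ v, #{i | v ∈ e i} ≤ d)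
    (F : Finset α) (hF : F.Nonempty) :
    ∃ w : α → ℝ, (∃ v ∈ F, w v ≠ 0) ∧ (∀ v ∉ F, w v = 0) ∧
      ∀ i, d < #(e i ∩ F) → ∑ v ∈ e i, w v = 0 := by
  classical
  let L : Finset ι := {i | d < #(e i ∩ F)}
  -- Double counting incidences gives fewer linear constraints than unknowns.
  have hcard : #L < #F := by
    have h1 : ∑ i ∈ L, #(e i ∩ F) ≤ d * #F := by
      calc ∑ i ∈ L, #(e i ∩ F) = ∑ i ∈ L, ∑ v ∈ F, if v ∈ e i then 1 else 0 := by
            refine sum_congr rfl fun i _ => ?_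
            rw [← card_filter, inter_comm, filter_mem_eq_inter]
        _ = ∑ v ∈ F, ∑ i ∈ L, if v ∈ e i then 1 else 0 := sum_comm
        _ ≤ ∑ v ∈ F, d := by
            refine sum_le_sum fun v _ => ?_
            rw [← card_filter]
            exact (card_le_card (filter_subset_filter _ (subset_univ _))).trans (hdeg v)
        _ = d * #F := by rw [sum_const, smul_eq_mul, mul_comm]
    have h2 : #L * (d + 1) ≤ ∑ i ∈ L, #(e i ∩ F) := by
      rw [← smul_eq_mul]
      exact card_nsmul_le_sum _ _ _ fun i hi => (mem_filter.1 hi).2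
    have h3 := hF.card_pos
    by_contra! h
    nlinarith
  let ext : (F → ℝ) → α → ℝ := fun w v => if h : v ∈ F then w ⟨v, h⟩ else 0
  let T : (F → ℝ) →ₗ[ℝ] (L → ℝ) :=
    { toFun := fun w i => ∑ v ∈ e i, ext w v
      map_add' := fun w w' => by
        ext i
        simp only [Pi.add_apply, ← sum_add_distrib]
        refine sum_congr rfl fun v _ => ?_
        by_cases h : v ∈ F <;> simp [ext, h]
      map_smul' := fun c w => by
        ext i
        simp only [Pi.smul_apply, smul_eq_mul, mul_sum, RingHom.id_apply]
        refine sum_congr rfl fun v _ => ?_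
        by_cases h : v ∈ F <;> simp [ext, h] }
  have hker : LinearMap.ker T ≠ ⊥ := LinearMap.ker_ne_bot_of_finrank_lt (by simpa using hcard)
  obtain ⟨w, hw, hw0⟩ := (Submodule.ne_bot_iff _).1 hker
  obtain ⟨v, hv⟩ := Function.ne_iff.1 hw0
  refine ⟨ext w, ⟨v, v.2, by simpa [ext] using hv⟩, fun v hv => by simp [ext, hv], fun i hi => ?_⟩
  exact congrFun (LinearMap.mem_ker.1 hw) ⟨i, mem_filter.2 ⟨mem_univ _, hi⟩⟩

/-- From a point of the open cube one can move in any nonzero direction until the boundary of the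
cube is reached. -/
theorem exists_pos_add_mul_mem_boundary {α : Type*} (F : Finset α) (x w : α → ℝ)
    (hx : ∀ v ∈ F, 0 < x v ∧ x v < 1) (hw : ∃ v ∈ F, w v ≠ 0) :
    ∃ T : ℝ, (∀ v ∈ F, 0 ≤ x v + T * w v ∧ x v + T * w v ≤ 1) ∧
      ∃ v ∈ F, x v + T * w v = 0 ∨ x v + T * w v = 1 := by
  classical
  -- Time at which coordinate `v` reaches the face it moves towards; the smallest one is the exit
  -- time.
  let τ : α → ℝ := fun v => if 0 < w v then (1 - x v) / w v else -x v / w v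
  obtain ⟨u, hu, humin⟩ := Finset.exists_min_image {v ∈ F | w v ≠ 0} τ
    (by obtain ⟨v, hv, h⟩ := hw; exact ⟨v, Finset.mem_filter.2 ⟨hv, h⟩⟩)
  obtain ⟨huF, hu0⟩ := Finset.mem_filter.1 hu
  have hτ : 0 ≤ τ u := by
    obtain ⟨h0, h1⟩ := hx u huF
    by_cases h : 0 < w u
    · simp only [τ, h, if_true]
      exact div_nonneg (by linarith) h.le
    · simp only [τ, h, if_false]
      exact div_nonneg_of_nonpos (by linarith) (not_lt.1 h)
  refine ⟨τ u, fun v hv => ?_, u, huF, ?_⟩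
  · obtain ⟨h0, h1⟩ := hx v hv
    rcases lt_trichotomy (w v) 0 with h | h | h
    · have := humin v (Finset.mem_filter.2 ⟨hv, h.ne⟩)
      simp only [τ, h.not_gt, if_false] at this
      have h2 := (le_div_iff_of_neg h).1 this
      have h3 := mul_nonpos_of_nonneg_of_nonpos hτ h.le
      constructor <;> linarith
    · simp [h, h0.le, h1.le]
    · have := humin v (Finset.mem_filter.2 ⟨hv, h.ne'⟩)
      simp only [τ, h, if_true] at this
      have h2 := (le_div_iff₀ h).1 this
      have h3 := mul_nonneg hτ h.le
      constructor <;> linarith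
  · by_cases h : 0 < w u
    · right
      simp only [τ, h, if_true]
      field_simp
      ring
    · left
      simp only [τ, h, if_false]
      field_simp
      ring

open Finset in
/-- **Beck–Fiala theorem**, rounding form: if every vertex lies in at most `d` of the sets `e i`,
then every weighting with values in `[0, 1]` can be rounded to a weighting with values in `{0, 1}`
such that the weight of each `e i` changes by less than `d`. -/
theorem beck_fiala_rounding {α ι : Type*} [Fintype α] [DecidableEq α]
    [Fintype ι] (e : ι → Finset α) (d : ℕ) (hd : 1 ≤ d) (hdeg : ∀ v, #{i | v ∈ e i} ≤ d)
    (x : α → ℝ) (hx : ∀ v, 0 ≤ x v ∧ x v ≤ 1) :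
    ∃ y : α → ℝ, (∀ v, y v = 0 ∨ y v = 1) ∧ (∀ v, x v = 0 ∨ x v = 1 → y v = x v) ∧
      ∀ i, |∑ v ∈ e i, y v - ∑ v ∈ e i, x v| < d := by
  classical
  induction hn : #{v | ¬ (x v = 0 ∨ x v = 1)} using Nat.strong_induction_on generalizing x with
  | _ n ih =>
  set F : Finset α := {v | ¬ (x v = 0 ∨ x v = 1)} with hFdef
  rcases F.eq_empty_or_nonempty with hF | hF
  · refine ⟨x, fun v => ?_, fun v _ => rfl, fun i => by simpa using Nat.lt_of_lt_of_le one_pos hd⟩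
    by_contra h
    exact notMem_empty v (hF ▸ mem_filter.2 ⟨mem_univ _, h⟩)
  have hFx : ∀ v ∈ F, 0 < x v ∧ x v < 1 := fun v hv => by
    have h := (mem_filter.1 hv).2
    push Not at h
    exact ⟨lt_of_le_of_ne (hx v).1 h.1.symm, lt_of_le_of_ne (hx v).2 h.2⟩
  have hnF : ∀ v, v ∉ F ↔ (x v = 0 ∨ x v = 1) := fun v => by simp [hFdef]; tauto
  obtain ⟨w, hw, hwF, hwe⟩ := exists_ne_zero_sum_eq_zero_of_degree_le e d hdeg F hF
  obtain ⟨T, hT, u, huF, hu⟩ := exists_pos_add_mul_mem_boundary F x w hFx hw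
  have hfix : ∀ v, v ∉ F → x v + T * w v = x v := fun v hv => by simp [hwF v hv]
  obtain ⟨y, hy, hyx, hye⟩ := ih _ (by
      rw [← hn]
      refine card_lt_card (ssubset_iff_of_subset (fun v hv => ?_) |>.2 ⟨u, huF, ?_⟩)
      · by_contra h
        exact (mem_filter.1 hv).2 (by simpa only [hfix v h] using (hnF v).1 h)
      · simpa only [mem_filter, mem_univ, true_and, not_not] using hu)
    (fun v => x v + T * w v) (fun v => by
      by_cases hv : v ∈ F
      · exact hT v hv
      · simpa only [hfix v hv] using hx v) rfl
  have hyF : ∀ v, v ∉ F → y v = x v := fun v hv => by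
    rw [hyx v (by simpa only [hfix v hv] using (hnF v).1 hv), hfix v hv]
  refine ⟨y, hy, fun v hv => hyF v ((hnF v).2 hv), fun i => ?_⟩
  -- A set with more than `d` fractional vertices keeps its sum in this move. Any other set has at
  -- most `d` vertices still able to change, each by less than 1, whatever the later moves are.
  by_cases hi : d < #(e i ∩ F)
  · have := hye i
    rwa [sum_add_distrib, ← mul_sum, hwe i hi, mul_zero, add_zero] at this
  · rw [← sum_sub_distrib, ← sum_inter_add_sum_sdiff (e i) F,
      sum_eq_zero (s := e i \ F) fun v hv => by
        rw [hyF v (mem_sdiff.1 hv).2, sub_self], add_zero]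
    rcases (e i ∩ F).eq_empty_or_nonempty with h0 | h0
    · rw [h0]
      simpa using Nat.lt_of_lt_of_le one_pos hd
    · calc |∑ v ∈ e i ∩ F, (y v - x v)| ≤ ∑ v ∈ e i ∩ F, |y v - x v| := abs_sum_le_sum_abs _ _
        _ < ∑ v ∈ e i ∩ F, (1 : ℝ) := by
            refine sum_lt_sum_of_nonempty h0 fun v hv => ?_
            obtain ⟨h1, h2⟩ := hFx v (mem_inter.1 hv).2
            rw [abs_lt]
            rcases hy v with h | h <;> rw [h] <;> constructor <;> linarith
        _ ≤ d := by
            rw [sum_const, nsmul_eq_mul, mul_one]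
            exact_mod_cast not_lt.1 hi

/-! ### Blocks and strips -/

open Finset in
/-- Given `d` maps `c i` on a finite type all of whose fibres have at most `B` elements, where
`d ≤ B`, some set meets every fibre in at most `2 * d` points and meets every fibre with exactly
`B` elements. -/
theorem exists_finset_inter_fibre {α κ : Type*} [Fintype α] [DecidableEq α] [Fintype κ]
    [DecidableEq κ] {d B : ℕ} (hd : 1 ≤ d) (hB : d ≤ B) (c : Fin d → α → κ)
    (hc : ∀ i k, #{v | c i v = k} ≤ B) :
    ∃ X : Finset α, ∀ i k, #{v ∈ X | c i v = k} ≤ 2 * d ∧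
      (#{v | c i v = k} = B → 1 ≤ #{v ∈ X | c i v = k}) := by
  classical
  have hB0 : (0 : ℝ) < B := by exact_mod_cast hd.trans hB
  have hd0 : (0 : ℝ) < d := by exact_mod_cast hd
  have hdeg : ∀ v : α, #{p : Fin d × κ | v ∈ ({v | c p.1 v = p.2} : Finset α)} ≤ d := fun v => by
    calc _ ≤ #(univ.image fun i : Fin d => (i, c i v)) := card_le_card fun p hp => by
            have : c p.1 v = p.2 := by simpa using hp
            exact mem_image.2 ⟨p.1, mem_univ _, by rw [this]⟩
      _ ≤ d := card_image_le.trans (by simp)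
  obtain ⟨y, hy, -, hye⟩ := beck_fiala_rounding
    (fun p : Fin d × κ => ({v | c p.1 v = p.2} : Finset α)) d hd hdeg (fun _ => (d : ℝ) / B)
    (fun _ => ⟨by positivity, (div_le_one hB0).2 (by exact_mod_cast hB)⟩)
  refine ⟨({v | y v = 1} : Finset α), fun i k => ?_⟩
  have hsum : ∑ v ∈ ({v | c i v = k} : Finset α), y v =
      (#{v ∈ ({v | y v = 1} : Finset α) | c i v = k} : ℕ) := by
    rw [filter_filter, card_filter, sum_filter, Nat.cast_sum]
    refine sum_congr rfl fun v _ => ?_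
    rcases hy v with h | h <;> simp [h]
  have key := hye (i, k)
  simp only [hsum, sum_const, nsmul_eq_mul] at key
  rw [abs_lt] at key
  constructor
  · have h1 : (#{v | c i v = k} : ℝ) * (d / B) ≤ d := by
      calc (#{v | c i v = k} : ℝ) * (d / B) ≤ B * (d / B) := by
            gcongr
            exact hc i k
        _ = d := by field_simp
    have h2 : (#{v ∈ ({v | y v = 1} : Finset α) | c i v = k} : ℝ) < 2 * d := by linarith [key.2]
    exact_mod_cast h2.le
  -- A full block has weight exactly `d`, so a change strictly below `d` leaves it nonempty.
  · intro h
    rw [h, mul_div_cancel₀ _ hB0.ne'] at key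
    have : (0 : ℝ) < #{v ∈ ({v | y v = 1} : Finset α) | c i v = k} := by linarith [key.1]
    exact_mod_cast this

/-- A nonempty order-connected finite set of natural numbers is an interval. -/
theorem Finset.exists_eq_Ico_of_ordConnected (S : Finset ℕ) (hS : S.Nonempty)
    (hconn : ∀ a ∈ S, ∀ b ∈ S, ∀ c, a ≤ c → c ≤ b → c ∈ S) :
    ∃ j, S = Finset.Ico j (j + S.card) := by
  have h : S = Finset.Ico (S.min' hS) (S.max' hS + 1) := by
    ext c
    rw [Finset.mem_Ico, Nat.lt_succ_iff]
    exact ⟨fun hc => ⟨S.min'_le c hc, S.le_max' c hc⟩,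
      fun hc => hconn _ (S.min'_mem hS) _ (S.max'_mem hS) c hc.1 hc.2⟩
  refine ⟨S.min' hS, ?_⟩
  have hcard := congrArg Finset.card h
  rw [Nat.card_Ico] at hcard
  have hle := S.min'_le _ (S.max'_mem hS)
  rw [hcard, Nat.add_sub_cancel' (by omega)]
  exact h

/-- Any real function on a finite type is monotone with respect to some enumeration. -/
theorem exists_equiv_fin_forall_le {α : Type*} [Fintype α] (f : α → ℝ) :
    ∃ p : α ≃ Fin (Fintype.card α), ∀ v w, p v ≤ p w → f v ≤ f w := by
  let q := Fintype.equivFin α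
  let σ := Tuple.sort (f ∘ q.symm)
  refine ⟨q.trans σ.symm, fun v w h => ?_⟩
  simpa [σ] using Tuple.monotone_sort (f ∘ q.symm) h

open Finset in
/-- For `d` real functions on a finite type and every `m ≥ 1` there is a set that meets the preimage
of each closed interval having exactly `m` elements in at least one and at most `6 * d` points. -/
theorem exists_finset_hitting_preimage_Icc {α : Type*} [Fintype α] [DecidableEq α] {d m : ℕ}
    (hd : 1 ≤ d) (hm : 1 ≤ m) (f : Fin d → α → ℝ) :
    ∃ X : Finset α, ∀ i a b, #{v | a ≤ f i v ∧ f i v ≤ b} = m →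
      1 ≤ #{v ∈ X | a ≤ f i v ∧ f i v ≤ b} ∧ #{v ∈ X | a ≤ f i v ∧ f i v ≤ b} ≤ 6 * d := by
  classical
  obtain ⟨B, hB1, hB2⟩ : ∃ B, 2 * B ≤ m + 1 ∧ m ≤ 2 * B := ⟨(m + 1) / 2, by omega, by omega⟩
  by_cases hdB : B < d
  -- Here `m ≤ 2 * B < 2 * d`, so all points may be taken.
  · exact ⟨univ, fun i a b h => by rw [h]; omega⟩
  push Not at hdB
  have hB0 : 0 < B := by omega
  -- Ties are broken arbitrarily: a closed interval still pulls back to consecutive positions.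
  choose p hp using fun i => exists_equiv_fin_forall_le (f i)
  have hinj : ∀ i, Function.Injective fun v => (p i v : ℕ) := fun i v w h =>
    (p i).injective (Fin.ext h)
  let c : Fin d → α → Fin (Fintype.card α + 1) := fun i v =>
    ⟨(p i v : ℕ) / B, ((Nat.div_le_self _ _).trans (p i v).2.le).trans_lt (Nat.lt_succ_self _)⟩
  have hblock : ∀ (i) (k : Fin (Fintype.card α + 1)) v,
      c i v = k ↔ (p i v : ℕ) ∈ Ico (k * B : ℕ) (k * B + B) := fun i k v => by
    rw [Fin.ext_iff, mem_Ico, Nat.div_eq_iff hB0]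
    omega
  obtain ⟨X, hX⟩ := exists_finset_inter_fibre hd hdB c fun i k => by
    rw [← card_image_of_injective _ (hinj i)]
    refine (card_le_card (t := Ico (k * B : ℕ) (k * B + B)) fun n hn => ?_).trans (by simp)
    obtain ⟨v, hv, rfl⟩ := mem_image.1 hn
    exact (hblock i k v).1 (mem_filter.1 hv).2
  refine ⟨X, fun i a b hcard => ?_⟩
  set W : Finset α := {v | a ≤ f i v ∧ f i v ≤ b} with hW
  have hWne : W.Nonempty := card_pos.1 (by omega)
  obtain ⟨j, hj⟩ := Finset.exists_eq_Ico_of_ordConnected (W.image fun v => (p i v : ℕ))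
    (hWne.image _) (by
      intro s hs t ht n hsn hnt
      obtain ⟨v, hv, rfl⟩ := mem_image.1 hs
      obtain ⟨w, hw, rfl⟩ := mem_image.1 ht
      have hn : n < Fintype.card α := hnt.trans_lt (p i w).2
      refine mem_image.2 ⟨(p i).symm ⟨n, hn⟩, mem_filter.2 ⟨mem_univ _, ?_, ?_⟩, by simp⟩
      · exact (mem_filter.1 hv).2.1.trans (hp i _ _ (by simpa [Fin.le_def] using hsn))
      · exact (hp i _ _ (by simpa [Fin.le_def] using hnt)).trans (mem_filter.1 hw).2.2)
  rw [card_image_of_injective _ (hinj i), hcard] at hj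
  have hmem : ∀ v, v ∈ W ↔ (p i v : ℕ) ∈ Ico j (j + m) := fun v => by
    rw [← hj]
    exact ((hinj i).mem_finset_image).symm
  have hjcard : ∀ n ∈ Ico j (j + m), n < Fintype.card α := fun n hn => by
    obtain ⟨v, -, rfl⟩ := mem_image.1 (hj ▸ hn)
    exact (p i v).2
  have hXW : ({v ∈ X | a ≤ f i v ∧ f i v ≤ b} : Finset α) = {v ∈ X | v ∈ W} := by
    simp [hW]
  rw [hXW]
  constructor
  · obtain ⟨k, hk1, hk2⟩ : ∃ k, j ≤ k * B ∧ k * B + B ≤ j + m := by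
      -- The first block starting at or after `j`, with index `⌈j / B⌉`, ends by `j + 2 * B - 1 ≤ j
      -- + m`.
      refine ⟨(j + B - 1) / B, ?_, ?_⟩
      · have := Nat.lt_div_mul_add (a := j + B - 1) hB0
        omega
      · have := Nat.div_mul_le_self (j + B - 1) B
        omega
    have hsub : Ico (k * B) (k * B + B) ⊆ Ico j (j + m) := Ico_subset_Ico hk1 hk2
    have hk : k < Fintype.card α + 1 := by
      have := hjcard (k * B) (hsub (by simp [hB0]))
      have := Nat.le_mul_of_pos_right k hB0
      omega
    have hfull : #{v | c i v = ⟨k, hk⟩} = B := by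
      rw [← card_image_of_injective _ (hinj i)]
      have : image (fun v => (p i v : ℕ)) {v | c i v = ⟨k, hk⟩} = Ico (k * B) (k * B + B) := by
        ext n
        constructor
        · intro hn
          obtain ⟨v, hv, rfl⟩ := mem_image.1 hn
          exact (hblock i _ v).1 (mem_filter.1 hv).2
        · intro hn
          refine mem_image.2 ⟨(p i).symm ⟨n, hjcard n (hsub hn)⟩, mem_filter.2 ⟨mem_univ _, ?_⟩,
            by simp⟩
          rw [hblock]
          simpa using hn
      rw [this]
      simp
    refine ((hX i ⟨k, hk⟩).2 hfull).trans (card_le_card fun v hv => ?_)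
    obtain ⟨hvX, hv⟩ := mem_filter.1 hv
    exact mem_filter.2 ⟨hvX, (hmem v).2 (hsub ((hblock i _ v).1 hv))⟩
  · let K : Finset (Fin (Fintype.card α + 1)) :=
      {k | (k : ℕ) ∈ Icc (j / B) (j / B + 2)}
    have hK : #K ≤ 3 := by
      rw [← card_image_of_injective K Fin.val_injective]
      refine (card_le_card (t := Icc (j / B) (j / B + 2)) fun n hn => ?_).trans
        (by rw [Nat.card_Icc]; omega)
      obtain ⟨k, hk, rfl⟩ := mem_image.1 hn
      exact (mem_filter.1 hk).2
    have hmaps : ∀ v ∈ ({v ∈ X | v ∈ W} : Finset α), c i v ∈ K := fun v hv => by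
      have h := mem_Ico.1 ((hmem v).1 (mem_filter.1 hv).2)
      refine mem_filter.2 ⟨mem_univ _, mem_Icc.2 ⟨Nat.div_le_div_right h.1, ?_⟩⟩
      calc (p i v : ℕ) / B ≤ (j + 2 * B) / B := Nat.div_le_div_right (by omega)
        _ = j / B + 2 := Nat.add_mul_div_right _ _ hB0
    calc #{v ∈ X | v ∈ W} ≤ (2 * d) * #K :=
          card_le_mul_card_image_of_maps_to hmaps _ fun k _ =>
            (card_le_card (filter_subset_filter _ (filter_subset _ _))).trans (hX i k).1
      _ ≤ (2 * d) * 3 := Nat.mul_le_mul_left _ hK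
      _ = 6 * d := by ring

/-- The hypergraph of the `m`-element sets cut out of a finite point set in `ℝ^d` by axis-aligned
strips has a `6 * d`-shallow hitting set. -/
theorem exists_isShallowHittingSet_strip {d m : ℕ} (hd : 1 ≤ d) (hm : 1 ≤ m)
    (V : Set (EuclideanSpace ℝ (Fin d))) (hV : V.Finite) :
    ∃ X, IsShallowHittingSet (uniformRangeHypergraph V (stripFamily d) m) (6 * d) X := by
  classical
  have : Fintype V := hV.fintype
  obtain ⟨X, hX⟩ := exists_finset_hitting_preimage_Icc hd hm (fun i (v : V) => v.1 i)
  refine ⟨Subtype.val '' (X : Set V), Subtype.coe_image_subset V _, ?_⟩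
  rintro e ⟨⟨R, ⟨i, a, b, rfl⟩, rfl⟩, he⟩
  have h1 : V ∩ strip i a b =
      Subtype.val '' (({v | a ≤ v.1 i ∧ v.1 i ≤ b} : Finset V) : Set V) := by
    ext v
    simp [strip]
    tauto
  have h2 : V ∩ strip i a b ∩ Subtype.val '' (X : Set V) =
      Subtype.val '' (({v ∈ X | a ≤ v.1 i ∧ v.1 i ≤ b} : Finset V) : Set V) := by
    ext v
    simp [strip]
    tauto
  rw [h1, Subtype.val_injective.encard_image, Set.encard_coe_eq_coe_finsetCard] at he
  rw [h2, Subtype.val_injective.encard_image, Set.encard_coe_eq_coe_finsetCard]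
  have h := hX i a b (by exact_mod_cast he)
  exact ⟨by exact_mod_cast h.1, by exact_mod_cast h.2⟩

/-! ### Passage to the asymptotic bound -/

theorem IsShallowHittingSet.mono {P : Type*} {H : Hypergraph P} {s t : ℕ} {X : Set P}
    (h : IsShallowHittingSet H s X) (hst : s ≤ t) : IsShallowHittingSet H t X :=
  ⟨h.1, fun e he => ⟨(h.2 e he).1, (h.2 e he).2.trans (by exact_mod_cast hst)⟩⟩

/-- The two sides differ by at most 2, while `c * d` tends to infinity. -/
theorem isEquivalent_ceil_mul_add_one {c : ℝ} (hc : 0 < c) :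
    Asymptotics.IsEquivalent Filter.atTop
      (fun d : ℕ => ((⌈c * d⌉₊ + 1 : ℕ) : ℝ)) (fun d : ℕ => c * (d : ℝ)) := by
  have hlim : Filter.Tendsto (fun d : ℕ => c * (d : ℝ)) Filter.atTop Filter.atTop :=
    tendsto_natCast_atTop_atTop.const_mul_atTop hc
  have hbdd : Asymptotics.IsBigO Filter.atTop
      ((fun d : ℕ => ((⌈c * d⌉₊ + 1 : ℕ) : ℝ)) - fun d : ℕ => c * (d : ℝ))
      (fun _ => (1 : ℝ)) := by
    refine Asymptotics.IsBigO.of_bound 2 (Filter.Eventually.of_forall fun d => ?_)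
    have h1 := Nat.le_ceil (c * (d : ℝ))
    have h2 := Nat.ceil_lt_add_one (a := c * (d : ℝ)) (by positivity)
    simp only [Pi.sub_apply, Nat.cast_add, Nat.cast_one, Real.norm_eq_abs, abs_one, mul_one]
    rw [abs_le]
    constructor <;> linarith
  refine hbdd.trans_isLittleO ?_
  rw [Asymptotics.isLittleO_const_left]
  exact Or.inr (tendsto_norm_atTop_atTop.comp hlim)

theorem mainTheorem3 :
    ∃ t : ℕ → ℕ,
      (∀ d : ℕ, 1 ≤ t d) ∧
      Asymptotics.IsEquivalent Filter.atTop
        (fun d : ℕ => (t d : ℝ)) (fun d : ℕ => 3 * Real.exp 1 * (d : ℝ)) ∧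
      ∀ (d m : ℕ), 1 ≤ d → 1 ≤ m →
        ∀ V : Set (EuclideanSpace ℝ (Fin d)), V.Finite →
          ∃ X : Set (EuclideanSpace ℝ (Fin d)),
            IsShallowHittingSet (uniformRangeHypergraph V (stripFamily d) m) (t d) X := by
  -- The summand 1 keeps the value at `d = 0` positive.
  refine ⟨fun d => ⌈3 * Real.exp 1 * d⌉₊ + 1, fun d => Nat.le_add_left _ _,
    isEquivalent_ceil_mul_add_one (by positivity), fun d m hd hm V hV => ?_⟩
  obtain ⟨X, hX⟩ := exists_isShallowHittingSet_strip hd hm V hV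
  refine ⟨X, hX.mono ?_⟩
  have h1 : (2 : ℝ) ≤ Real.exp 1 := by linarith [Real.add_one_le_exp (1 : ℝ)]
  have h2 : ((6 * d : ℕ) : ℝ) ≤ 3 * Real.exp 1 * d := by
    push_cast
    gcongr
    linarith
  have h3 : 6 * d ≤ ⌈3 * Real.exp 1 * (d : ℝ)⌉₊ := by
    exact_mod_cast h2.trans (Nat.le_ceil _)
  exact h3.trans (Nat.le_succ _)
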